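/- Let $L_2(\mathbb R_+)$ be the space of (real- or complex-valued) functions that are square-integrable on $(0,\infty)$ with respect to Lebesgue measure, functions equal almost everywhere being identified. Let $g\in L_2(\mathbb R_+)$ be a given function. The integral equation of the second kind with the Stieltjes kernel $$f(x)+\frac1\pi\int_0^\infty\frac{f(t)}{x+t}\,dt=g(x),\qquad x>0,\tag{A}$$ has a unique solution $f\in L_2(\mathbb R_+)$, and it is given by $$f(x)=g(x)-\frac{2}{\pi^2}\int_0^\infty\frac{\sqrt{xt}\,(\log x-\log t)}{x^2-t^2}\,g(t)\,dt,\qquad x>0.\tag{B}$$ Conversely, for a given $f\in L_2(\mathbb R_+)$, the integral equation (B) has a unique solution $g\in L_2(\mathbb R_+)$, and it is given by formula (A). For all $f,g\in L_2(\mathbb R_+)$ the integrals in (A) and (B) converge absolutely for every $x>0$. -/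

import Mathlib

open MeasureTheory Set

noncomputable section

/-- Lebesgue measure on the half-line `(0, ∞)`. -/
def halfLine : Measure ℝ := volume.restrict (Ioi (0 : ℝ))

/-- The Stieltjes kernel `1 / (x + t)`. -/
def stieltjesKernel (x t : ℝ) : ℝ := 1 / (x + t)

/-- The kernel `√(x t) (log x - log t) / (x² - t²)`.
For `x > 0` its value on the null set `t = x` is irrelevant. -/
def logKernel (x t : ℝ) : ℝ :=
  Real.sqrt (x * t) * (Real.log x - Real.log t) / (x ^ 2 - t ^ 2)

/-- `f(x) + (1/π) ∫₀^∞ f(t) / (x + t) dt`. -/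
def stieltjesSide {𝕜 : Type*} [RCLike 𝕜] (f : ℝ → 𝕜) (x : ℝ) : 𝕜 :=
  f x + (1 / Real.pi) • ∫ t, stieltjesKernel x t • f t ∂halfLine

/-- `g(x) - (2/π²) ∫₀^∞ √(x t) (log x - log t) / (x² - t²) g(t) dt`. -/
def logSide {𝕜 : Type*} [RCLike 𝕜] (g : ℝ → 𝕜) (x : ℝ) : 𝕜 :=
  g x - (2 / Real.pi ^ 2) • ∫ t, logKernel x t • g t ∂halfLine

end

/-! Write S and L for the integral operators with the Stieltjes and the logarithmic kernel.
Everything rests on SL = LS = (π²/2)S − πL: expanding (1 + S/π)(1 − (2/π²)L), in either order, then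
leaves 1, so (A) and (B) are mutually inverse. At the level of kernels this is
`integral_stieltjesKernel_mul_logKernel`, proved by partial fractions from explicit integrals of log
y / (√y (y ± a)). Passing to operators needs Fubini. Since 0 ≤ L ≤ S pointwise
(`logKernel_nonneg_and_le`), it suffices to bound S on L₂, by Schur's test with weight t^(-1/2). -/

/-! ### Explicit logarithmic integrals -/

open Filter Topology Real in
theorem integrableOn_and_integral_log_mul_rpow_Ioi_one {a : ℝ} (ha : 0 < a) :
    IntegrableOn (fun y : ℝ => log y * y ^ (-a - 1)) (Ioi 1) ∧
      ∫ y in Ioi (1 : ℝ), log y * y ^ (-a - 1) = 1 / a ^ 2 := by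
  have hd : ∀ y ∈ Ici (1 : ℝ), HasDerivAt (fun y : ℝ => -(log y * y ^ (-a) / a + y ^ (-a) / a ^ 2))
      (log y * y ^ (-a - 1)) y := by
    intro y hy
    have hy0 : 0 < y := lt_of_lt_of_le one_pos hy
    have h1 := hasDerivAt_rpow_const (x := y) (p := -a) (Or.inl hy0.ne')
    have h2 := hasDerivAt_log hy0.ne'
    refine (((h2.mul h1).div_const a).add (h1.div_const (a ^ 2))).neg.congr_deriv ?_
    rw [rpow_sub_one hy0.ne']
    field_simp
    ring
  have hc : ContinuousWithinAt (fun y : ℝ => -(log y * y ^ (-a) / a + y ^ (-a) / a ^ 2))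
      (Ici 1) 1 := (hd 1 self_mem_Ici).continuousAt.continuousWithinAt
  have hn : ∀ y ∈ Ioi (1 : ℝ), 0 ≤ log y * y ^ (-a - 1) := fun y hy =>
    mul_nonneg (log_nonneg (le_of_lt hy)) (rpow_nonneg (zero_le_one.trans (le_of_lt hy)) _)
  have ht : Tendsto (fun y : ℝ => -(log y * y ^ (-a) / a + y ^ (-a) / a ^ 2)) atTop (𝓝 0) := by
    have h1 : Tendsto (fun y : ℝ => y ^ (-a)) atTop (𝓝 0) := tendsto_rpow_neg_atTop ha
    have h2 : Tendsto (fun y : ℝ => log y * y ^ (-a)) atTop (𝓝 0) := by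
      refine (isLittleO_log_rpow_atTop ha).tendsto_div_nhds_zero.congr' ?_
      filter_upwards [eventually_gt_atTop 0] with y hy
      rw [rpow_neg hy.le, div_eq_mul_inv]
    simpa using ((h2.div_const a).add (h1.div_const (a ^ 2))).neg
  have hd' := fun y (hy : y ∈ Ioi (1 : ℝ)) => hd y (mem_Ici.2 (le_of_lt hy))
  refine ⟨integrableOn_Ioi_deriv_of_nonneg hc hd' hn ht, ?_⟩
  rw [integral_Ioi_of_hasDerivAt_of_nonneg hc hd' hn ht]
  simp

/-- Four times the odd part of ζ(2), whose even part is ζ(2)/4. -/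
theorem hasSum_inv_nat_add_half_sq :
    HasSum (fun k : ℕ => 1 / ((k : ℝ) + 1 / 2) ^ 2) (Real.pi ^ 2 / 2) := by
  have he : HasSum (fun k : ℕ => 1 / ((2 * k : ℕ) : ℝ) ^ 2) (1 / 4 * (Real.pi ^ 2 / 6)) := by
    have h := hasSum_zeta_two.mul_left (1 / 4)
    have hf : (fun k : ℕ => 1 / ((2 * k : ℕ) : ℝ) ^ 2) =
        fun k : ℕ => 1 / 4 * (1 / (k : ℝ) ^ 2) := by
      ext k
      push_cast
      rw [mul_pow, one_div_mul_one_div]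
      norm_num
    rwa [hf]
  have hinj : Function.Injective fun k : ℕ => 2 * k + 1 := fun a b h => by
    simp only at h
    omega
  have ho : Summable (fun k : ℕ => 1 / ((2 * k + 1 : ℕ) : ℝ) ^ 2) :=
    hasSum_zeta_two.summable.comp_injective hinj
  obtain ⟨m, hm⟩ := ho
  have hs := (HasSum.even_add_odd (f := fun n : ℕ => 1 / (n : ℝ) ^ 2) he hm).unique
    hasSum_zeta_two
  have h := hm.mul_left 4
  have hf : (fun k : ℕ => 1 / ((k : ℝ) + 1 / 2) ^ 2) =
      fun k : ℕ => 4 * (1 / ((2 * k + 1 : ℕ) : ℝ) ^ 2) := by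
    ext k
    push_cast
    rw [show (2 * (k : ℝ) + 1) = 2 * (k + 1 / 2) by ring, mul_pow, ← one_div_mul_one_div]
    ring
  rw [show 4 * m = Real.pi ^ 2 / 2 by linarith] at h
  rwa [hf]

-- For y > 1, expand 1/(y − 1) in powers of 1/y and integrate termwise; the terms are nonnegative
-- and their integrals summable.
open Real in
theorem integrableOn_and_integral_log_div_sub_one_Ioi_one :
    IntegrableOn (fun y : ℝ => log y / (√y * (y - 1))) (Ioi 1) ∧
      ∫ y in Ioi (1 : ℝ), log y / (√y * (y - 1)) = π ^ 2 / 2 := by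
  set F : ℕ → ℝ → ℝ := fun k y => log y * y ^ (-((k : ℝ) + 1 / 2) - 1)
  have hF := fun k : ℕ => integrableOn_and_integral_log_mul_rpow_Ioi_one
    (a := (k : ℝ) + 1 / 2) (by positivity)
  have hnorm : ∀ k, ∫ y in Ioi (1 : ℝ), ‖F k y‖ = 1 / ((k : ℝ) + 1 / 2) ^ 2 := by
    intro k
    rw [← (hF k).2]
    refine setIntegral_congr_fun measurableSet_Ioi fun y hy => ?_
    exact norm_of_nonneg (mul_nonneg (log_nonneg (le_of_lt hy))
      (rpow_nonneg (zero_le_one.trans (le_of_lt hy)) _))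
  have hs := hasSum_integral_of_summable_integral_norm (fun k => (hF k).1)
    (by simp_rw [F] at hnorm; simp_rw [hnorm]; exact hasSum_inv_nat_add_half_sq.summable)
  simp_rw [(hF _).2] at hs
  have hval := hs.unique hasSum_inv_nat_add_half_sq
  have hcongr : ∫ y in Ioi (1 : ℝ), ∑' k : ℕ, F k y =
      ∫ y in Ioi (1 : ℝ), log y / (√y * (y - 1)) := by
    refine setIntegral_congr_fun measurableSet_Ioi fun y hy => ?_
    have hy1 : 1 < y := hy
    have hy0 : 0 < y := one_pos.trans hy1
    have hterm : ∀ k : ℕ, F k y = (log y / (√y * y)) * (y⁻¹) ^ k := by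
      intro k
      have : -((k : ℝ) + 1 / 2) - 1 = -(k : ℝ) - 1 / 2 - 1 := by ring
      simp only [F]
      rw [this, rpow_sub_one hy0.ne', rpow_sub hy0, rpow_neg hy0.le, rpow_natCast, ← sqrt_eq_rpow, inv_pow]
      field_simp
    simp_rw [hterm]
    rw [tsum_mul_left, tsum_geometric_of_lt_one (by positivity) (inv_lt_one_of_one_lt₀ hy1)]
    have h1 : y - 1 ≠ 0 := by linarith
    have h3 : 0 < √y := sqrt_pos.2 hy0
    have h2 : 1 - y⁻¹ = (y - 1) / y := by field_simp
    rw [h2]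
    field_simp
  have hI : ∫ y in Ioi (1 : ℝ), log y / (√y * (y - 1)) = π ^ 2 / 2 := hcongr.symm.trans hval
  -- A nonintegrable function would have integral 0 by convention.
  exact ⟨Integrable.of_integral_ne_zero (by rw [hI]; positivity), hI⟩

theorem setIntegral_comp_inv_Ioi (g : ℝ → ℝ) :
    ∫ y in Ioi (0 : ℝ), (y ^ 2)⁻¹ * g y⁻¹ = ∫ y in Ioi (0 : ℝ), g y := by
  rw [← integral_comp_rpow_Ioi g (p := -1) (by norm_num)]
  refine setIntegral_congr_fun measurableSet_Ioi fun y hy => ?_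
  have hy0 : 0 < y := hy
  have : y ^ (-1 - 1 : ℝ) = (y ^ 2)⁻¹ := by
    rw [show (-1 - 1 : ℝ) = -(2 : ℕ) by norm_num, Real.rpow_neg hy0.le, Real.rpow_natCast]
  simp [this, Real.rpow_neg_one]

theorem integrableOn_comp_inv_Ioi {g : ℝ → ℝ} (hg : IntegrableOn g (Ioi 0)) :
    IntegrableOn (fun y : ℝ => (y ^ 2)⁻¹ * g y⁻¹) (Ioi 0) := by
  rw [← integrableOn_Ioi_comp_rpow_iff g (p := -1) (by norm_num)] at hg
  refine hg.congr_fun (fun y hy => ?_) measurableSet_Ioi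
  have hy0 : 0 < y := hy
  have : y ^ (-1 - 1 : ℝ) = (y ^ 2)⁻¹ := by
    rw [show (-1 - 1 : ℝ) = -(2 : ℕ) by norm_num, Real.rpow_neg hy0.le, Real.rpow_natCast]
  simp [this, Real.rpow_neg_one]

open Real in
theorem integrableOn_and_integral_log_div_sub_one :
    IntegrableOn (fun y : ℝ => log y / (√y * (y - 1))) (Ioi 0) ∧
      ∫ y in Ioi (0 : ℝ), log y / (√y * (y - 1)) = π ^ 2 := by
  obtain ⟨hi, hv⟩ := integrableOn_and_integral_log_div_sub_one_Ioi_one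
  set h : ℝ → ℝ := fun y => log y / (√y * (y - 1))
  set g : ℝ → ℝ := (Ioi 1).indicator h
  have hsub : Ioi (1 : ℝ) ⊆ Ioi 0 := Ioi_subset_Ioi zero_le_one
  have hg : IntegrableOn g (Ioi 0) := (hi.integrable_indicator measurableSet_Ioi).integrableOn
  have hgv : ∫ y in Ioi (0 : ℝ), g y = π ^ 2 / 2 := by
    rw [setIntegral_indicator measurableSet_Ioi, inter_eq_right.2 hsub, hv]
  -- The form h(y) dy is invariant under y ↦ 1/y, so (0, 1) contributes as much as (1, ∞).
  have heq : EqOn (fun y => g y + (y ^ 2)⁻¹ * g y⁻¹) h (Ioi 0) := by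
    intro y hy
    have hy0 : 0 < y := hy
    rcases lt_trichotomy y 1 with h1 | h1 | h1
    · have h2 : 1 < y⁻¹ := (one_lt_inv₀ hy0).2 h1
      have h3 : g y = 0 := indicator_of_notMem (by simp [h1.le]) _
      have h4 : g y⁻¹ = h y⁻¹ := indicator_of_mem (mem_Ioi.2 h2) _
      simp only [h3, h4, h, log_inv, sqrt_inv]
      have h5 : y - 1 ≠ 0 := by linarith
      have h6 : 0 < √y := sqrt_pos.2 hy0
      have h7 : y⁻¹ - 1 = -(y - 1) / y := by field_simp; ring
      rw [h7]
      field_simp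
      rw [zero_mul, zero_mul, zero_add, mul_left_comm, mul_self_sqrt hy0.le, mul_comm]
    · simp [h1, g, h]
    · have h2 : ¬ 1 < y⁻¹ := by
        rw [one_lt_inv₀ hy0]; linarith
      have h3 : g y = h y := indicator_of_mem (mem_Ioi.2 h1) _
      have h4 : g y⁻¹ = 0 := indicator_of_notMem (by simpa using h2) _
      simp [h3, h4]
  refine ⟨(hg.add (integrableOn_comp_inv_Ioi hg)).congr_fun heq measurableSet_Ioi, ?_⟩
  rw [← setIntegral_congr_fun measurableSet_Ioi heq,
    integral_add hg (integrableOn_comp_inv_Ioi hg), setIntegral_comp_inv_Ioi, hgv]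
  ring

-- Here inversion y ↦ 1/y changes the sign, so the integral equals its own negative.
open Real in
theorem integrableOn_and_integral_log_div_add_one :
    IntegrableOn (fun y : ℝ => log y / (√y * (y + 1))) (Ioi 0) ∧
      ∫ y in Ioi (0 : ℝ), log y / (√y * (y + 1)) = 0 := by
  constructor
  · refine Integrable.mono' integrableOn_and_integral_log_div_sub_one.1.norm
      (Measurable.aestronglyMeasurable (by fun_prop)) ?_
    filter_upwards [ae_restrict_mem measurableSet_Ioi] with y hy
    have hy0 : 0 < y := hy
    rw [norm_div, norm_div, norm_mul, norm_mul]
    rcases eq_or_ne y 1 with rfl | h1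
    · simp
    have h2 : 0 < ‖y - 1‖ := norm_pos_iff.2 (sub_ne_zero.2 h1)
    have h3 : 0 < ‖√y‖ := norm_pos_iff.2 (sqrt_pos.2 hy0).ne'
    have h4 : ‖y - 1‖ ≤ ‖y + 1‖ := by
      rw [norm_eq_abs, norm_eq_abs, abs_of_pos (by linarith : 0 < y + 1), abs_le]
      constructor <;> linarith
    gcongr
  · have h := setIntegral_comp_inv_Ioi (fun y : ℝ => log y / (√y * (y + 1)))
    rw [setIntegral_congr_fun (g := fun y : ℝ => -(log y / (√y * (y + 1)))) measurableSet_Ioi,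
      integral_neg] at h
    · linarith
    · intro y hy
      have hy0 : 0 < y := hy
      have h6 : 0 < √y := sqrt_pos.2 hy0
      have h7 : y⁻¹ + 1 = (y + 1) / y := by field_simp; ring
      simp only [log_inv, sqrt_inv]
      rw [h7]
      field_simp
      rw [sq_sqrt hy0.le]
      ring

open Real Filter Topology in
theorem integrableOn_and_integral_inv_sqrt_mul_add {a : ℝ} (ha : 0 < a) :
    IntegrableOn (fun y : ℝ => 1 / (√y * (y + a))) (Ioi 0) ∧
      ∫ y in Ioi (0 : ℝ), 1 / (√y * (y + a)) = π / √a := by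
  have hs : 0 < √a := sqrt_pos.2 ha
  have hd : ∀ y ∈ Ioi (0 : ℝ), HasDerivAt (fun y : ℝ => 2 / √a * arctan (√y / √a))
      (1 / (√y * (y + a))) y := by
    intro y hy
    have hy0 : 0 < y := hy
    have hsy : 0 < √y := sqrt_pos.2 hy0
    refine ((((hasDerivAt_sqrt hy0.ne').div_const (√a)).arctan).const_mul (2 / √a)).congr_deriv ?_
    rw [div_pow, sq_sqrt hy0.le, sq_sqrt ha.le]
    field_simp
    rw [sq_sqrt ha.le]
    field_simp
    ring
  have hc : ContinuousWithinAt (fun y : ℝ => 2 / √a * arctan (√y / √a)) (Ici 0) 0 := by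
    apply Continuous.continuousWithinAt; fun_prop
  have hn : ∀ y ∈ Ioi (0 : ℝ), 0 ≤ 1 / (√y * (y + a)) := fun y hy => by
    have hy0 : 0 < y := hy
    positivity
  have ht : Tendsto (fun y : ℝ => 2 / √a * arctan (√y / √a)) atTop (𝓝 (π / √a)) := by
    have h1 : Tendsto (fun y : ℝ => √y / √a) atTop atTop :=
      tendsto_sqrt_atTop.atTop_div_const hs
    have h2 := ((tendsto_arctan_atTop.mono_right nhdsWithin_le_nhds).comp h1).const_mul (2 / √a)
    rwa [show 2 / √a * (π / 2) = π / √a by ring] at h2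
  refine ⟨integrableOn_Ioi_deriv_of_nonneg hc hd hn ht, ?_⟩
  rw [integral_Ioi_of_hasDerivAt_of_nonneg hc hd hn ht]
  simp

-- Rescale by a and split log(y/b) = log(y/a) + log(a/b); the first part vanishes by the inversion
-- symmetry.
open Real in
theorem integrableOn_and_integral_log_div_div_add {a b : ℝ} (ha : 0 < a) (hb : 0 < b) :
    IntegrableOn (fun y : ℝ => log (y / b) / (√y * (y + a))) (Ioi 0) ∧
      ∫ y in Ioi (0 : ℝ), log (y / b) / (√y * (y + a)) = π / √a * log (a / b) := by
  obtain ⟨hi, hv⟩ := integrableOn_and_integral_log_div_add_one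
  have hi' : IntegrableOn (fun y : ℝ => log (a⁻¹ * y) / (√(a⁻¹ * y) * (a⁻¹ * y + 1))) (Ioi 0) :=
    (integrableOn_Ioi_comp_mul_left_iff _ 0 (inv_pos.2 ha)).2 (by simpa using hi)
  have hv' := integral_comp_mul_left_Ioi (fun y : ℝ => log y / (√y * (y + 1))) 0 (inv_pos.2 ha)
  rw [mul_zero, hv, smul_zero] at hv'
  obtain ⟨hj, hw⟩ := integrableOn_and_integral_inv_sqrt_mul_add ha
  have heq : EqOn (fun y : ℝ => (√a * a)⁻¹ * (log (a⁻¹ * y) / (√(a⁻¹ * y) * (a⁻¹ * y + 1))) +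
      log (a / b) * (1 / (√y * (y + a)))) (fun y : ℝ => log (y / b) / (√y * (y + a))) (Ioi 0) := by
    intro y hy
    have hy0 : 0 < y := hy
    have hsy : 0 < √y := sqrt_pos.2 hy0
    have hsa : 0 < √a := sqrt_pos.2 ha
    simp only
    rw [log_mul (by positivity) hy0.ne', log_inv, log_div ha.ne' hb.ne', log_div hy0.ne' hb.ne',
      sqrt_mul (by positivity), sqrt_inv]
    have h7 : a⁻¹ * y + 1 = (y + a) / a := by field_simp
    rw [h7]
    field_simp
    ring
  refine ⟨IntegrableOn.congr_fun ((hi'.const_mul _).add (hj.const_mul _)) heq measurableSet_Ioi, ?_⟩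
  rw [← setIntegral_congr_fun measurableSet_Ioi heq,
    integral_add (hi'.const_mul _) (hj.const_mul _), integral_const_mul, integral_const_mul,
    hv', hw]
  ring

open Real in
theorem integrableOn_and_integral_log_div_div_sub {b : ℝ} (hb : 0 < b) :
    IntegrableOn (fun y : ℝ => log (y / b) / (√y * (y - b))) (Ioi 0) ∧
      ∫ y in Ioi (0 : ℝ), log (y / b) / (√y * (y - b)) = π ^ 2 / √b := by
  obtain ⟨hi, hv⟩ := integrableOn_and_integral_log_div_sub_one
  have hi' : IntegrableOn (fun y : ℝ => log (b⁻¹ * y) / (√(b⁻¹ * y) * (b⁻¹ * y - 1))) (Ioi 0) :=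
    (integrableOn_Ioi_comp_mul_left_iff _ 0 (inv_pos.2 hb)).2 (by simpa using hi)
  have hv' := integral_comp_mul_left_Ioi (fun y : ℝ => log y / (√y * (y - 1))) 0 (inv_pos.2 hb)
  rw [mul_zero, hv, inv_inv, smul_eq_mul] at hv'
  have hsb : 0 < √b := sqrt_pos.2 hb
  have heq : EqOn (fun y : ℝ => (√b * b)⁻¹ * (log (b⁻¹ * y) / (√(b⁻¹ * y) * (b⁻¹ * y - 1))))
      (fun y : ℝ => log (y / b) / (√y * (y - b))) (Ioi 0) := by
    intro y hy
    have hy0 : 0 < y := hy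
    have hsy : 0 < √y := sqrt_pos.2 hy0
    simp only
    rcases eq_or_ne y b with rfl | hyb
    · simp [hb.ne']
    have hyb' := sub_ne_zero.2 hyb
    rw [sqrt_mul (by positivity), sqrt_inv, inv_mul_eq_div b y]
    have h7 : y / b - 1 = (y - b) / b := by field_simp
    rw [h7]
    field_simp
  refine ⟨IntegrableOn.congr_fun (hi'.const_mul _) heq measurableSet_Ioi, ?_⟩
  rw [← setIntegral_congr_fun measurableSet_Ioi heq, integral_const_mul, hv']
  field_simp

/-! ### Composition of the two kernels -/

open Real in
theorem integral_stieltjesKernel_mul_logKernel {x t : ℝ} (hx : 0 < x) (ht : 0 < t) (hxt : x ≠ t) :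
    ∫ y, stieltjesKernel x y * logKernel y t ∂halfLine =
      π ^ 2 / 2 * stieltjesKernel x t - π * logKernel x t := by
  obtain ⟨hi1, hv1⟩ := integrableOn_and_integral_log_div_div_add hx ht
  obtain ⟨hi2, hv2⟩ := integrableOn_and_integral_log_div_div_sub ht
  obtain ⟨hi3, hv3⟩ := integrableOn_and_integral_log_div_div_add ht ht
  have hxt' := sub_ne_zero.2 hxt
  have hst : 0 < √t := sqrt_pos.2 ht
  have hsx : 0 < √x := sqrt_pos.2 hx
  have hx2 : x ^ 2 - t ^ 2 = (x - t) * (x + t) := by ring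
  -- Partial fractions of y/((y + x)(y − t)(y + t)) in y. The last term integrates to 0, because its
  -- logarithm becomes log(t/t).
  have heq : EqOn (fun y : ℝ => stieltjesKernel x y * logKernel y t)
      (fun y : ℝ => -(√t * x / ((x - t) * (x + t))) * (log (y / t) / (√y * (y + x))) +
        √t / (2 * (x + t)) * (log (y / t) / (√y * (y - t))) +
        √t / (2 * (x - t)) * (log (y / t) / (√y * (y + t)))) (Ioi 0) := by
    intro y hy
    have hy0 : 0 < y := hy
    have hsy : 0 < √y := sqrt_pos.2 hy0
    simp only [stieltjesKernel, logKernel]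
    rcases eq_or_ne y t with rfl | hyt
    · simp [hy0.ne']
    have hyt' := sub_ne_zero.2 hyt
    have hy2 : y ^ 2 - t ^ 2 = (y - t) * (y + t) := by ring
    rw [sqrt_mul hy0.le, log_div hy0.ne' ht.ne', hy2]
    field_simp
    rw [sq_sqrt hy0.le]
    ring
  have hadd := integral_add ((hi1.const_mul (-(√t * x / ((x - t) * (x + t))))).add
    (hi2.const_mul (√t / (2 * (x + t))))) (hi3.const_mul (√t / (2 * (x - t))))
  simp only [Pi.add_apply] at hadd
  rw [halfLine, setIntegral_congr_fun measurableSet_Ioi heq, hadd,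
    integral_add (hi1.const_mul _) (hi2.const_mul _), integral_const_mul, integral_const_mul,
    integral_const_mul, hv1, hv2, hv3, div_self ht.ne', log_one, stieltjesKernel, logKernel,
    sqrt_mul hx.le, log_div hx.ne' ht.ne', hx2]
  field_simp
  linear_combination 2 * √t * (log x - log t) * sq_sqrt hx.le

/-! ### Symmetry, measurability and pointwise comparison of the kernels -/

instance : SFinite halfLine := by unfold halfLine; infer_instance

theorem stieltjesKernel_comm (x t : ℝ) : stieltjesKernel x t = stieltjesKernel t x := by
  simp [stieltjesKernel, add_comm]

theorem logKernel_comm (x t : ℝ) : logKernel x t = logKernel t x := by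
  rw [logKernel, logKernel, mul_comm x t, ← neg_sub (t ^ 2), ← neg_sub (Real.log t), mul_neg,
    neg_div_neg_eq]

theorem measurable_stieltjesKernel : Measurable (Function.uncurry stieltjesKernel) := by
  unfold stieltjesKernel Function.uncurry; fun_prop

theorem measurable_logKernel : Measurable (Function.uncurry logKernel) := by
  unfold logKernel Function.uncurry; fun_prop

theorem ae_halfLine_pos : ∀ᵐ x ∂halfLine, 0 < x := ae_restrict_mem measurableSet_Ioi

theorem ae_halfLine_ne (x : ℝ) : ∀ᵐ t ∂halfLine, x ≠ t := by
  have h : ∀ᵐ t ∂(volume : Measure ℝ), t ≠ x := by simp [ae_iff]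
  filter_upwards [ae_restrict_of_ae h] with t ht using ht.symm

theorem stieltjesKernel_nonneg {x t : ℝ} (hx : 0 < x) (ht : 0 < t) : 0 ≤ stieltjesKernel x t := by
  unfold stieltjesKernel; positivity

-- With s = log √(x/t), the upper bound is s ≤ sinh s.
open Real in
theorem logKernel_nonneg_and_le_of_lt {x t : ℝ} (ht : 0 < t) (hxt : t < x) :
    0 ≤ logKernel x t ∧ logKernel x t ≤ stieltjesKernel x t := by
  have hx : 0 < x := ht.trans hxt
  have hst : 0 < √t := sqrt_pos.2 ht
  have hsx : 0 < √x := sqrt_pos.2 hx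
  have h2 : 0 < x ^ 2 - t ^ 2 := by nlinarith
  have hlog : 0 ≤ log x - log t := sub_nonneg.2 (log_le_log ht hxt.le)
  refine ⟨by unfold logKernel; positivity, ?_⟩
  have hq : 0 < √x / √t := by positivity
  have hle : log (√x / √t) ≤ (√x / √t - (√x / √t)⁻¹) / 2 := by
    rw [← sinh_log hq, self_le_sinh_iff]
    exact log_nonneg ((one_le_div hst).2 (sqrt_le_sqrt hxt.le))
  rw [log_div hsx.ne' hst.ne', log_sqrt hx.le, log_sqrt ht.le] at hle
  have h3 : √x / √t - (√x / √t)⁻¹ = (x - t) / (√x * √t) := by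
    rw [inv_div, div_sub_div _ _ hst.ne' hsx.ne', mul_self_sqrt hx.le, mul_self_sqrt ht.le,
      mul_comm (√t)]
  rw [h3] at hle
  have h4 : log x - log t ≤ (x - t) / (√x * √t) := by linarith
  rw [le_div_iff₀ (by positivity)] at h4
  rw [logKernel, stieltjesKernel, div_le_div_iff₀ h2 (by positivity), sqrt_mul hx.le]
  nlinarith

theorem logKernel_nonneg_and_le {x t : ℝ} (hx : 0 < x) (ht : 0 < t) :
    0 ≤ logKernel x t ∧ logKernel x t ≤ stieltjesKernel x t := by
  rcases lt_trichotomy x t with h | rfl | h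
  · rw [logKernel_comm, stieltjesKernel_comm]
    exact logKernel_nonneg_and_le_of_lt hx h
  · exact ⟨by simp [logKernel], by simpa [logKernel] using stieltjesKernel_nonneg hx hx⟩
  · exact logKernel_nonneg_and_le_of_lt ht h

/-! ### Schur's test and boundedness on L₂ -/

-- The weight t^(-1/2) is an eigenfunction of the Stieltjes kernel with eigenvalue π, which supplies
-- the Schur constant.
open Real in
theorem lintegral_stieltjesKernel_mul_inv_sqrt {x : ℝ} (hx : 0 < x) :
    ∫⁻ t, ENNReal.ofReal (stieltjesKernel x t) * ENNReal.ofReal (1 / √t) ∂halfLine =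
      ENNReal.ofReal π * ENNReal.ofReal (1 / √x) := by
  have hint := integrableOn_and_integral_inv_sqrt_mul_add hx
  rw [← ENNReal.ofReal_mul pi_pos.le, mul_one_div, ← hint.2,
    ofReal_integral_eq_lintegral_ofReal hint.1]
  · refine setLIntegral_congr_fun measurableSet_Ioi fun t ht => ?_
    have ht0 : 0 < t := ht
    rw [← ENNReal.ofReal_mul (stieltjesKernel_nonneg hx ht0), stieltjesKernel]
    congr 1
    rw [one_div_mul_one_div, mul_comm, add_comm]
  · filter_upwards [ae_restrict_mem measurableSet_Ioi] with t ht
    have ht0 : 0 < t := ht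
    simp only [Pi.zero_apply]
    positivity

/-- The Schur test with a weight `w`. -/
theorem lintegral_sq_lintegral_mul_le {α : Type*} [MeasurableSpace α] {μ : Measure α} [SFinite μ]
    {k : α → α → ENNReal} {w u : α → ENNReal} {c : ENNReal}
    (hk : Measurable (Function.uncurry k)) (hsymm : ∀ x t, k x t = k t x) (hw : Measurable w)
    (hw0 : ∀ᵐ t ∂μ, w t ≠ 0 ∧ w t ≠ ⊤) (hu : AEMeasurable u μ)
    (hc : ∀ᵐ x ∂μ, ∫⁻ t, k x t * w t ∂μ ≤ c * w x) :
    ∫⁻ x, (∫⁻ t, k x t * u t ∂μ) ^ 2 ∂μ ≤ c ^ 2 * ∫⁻ t, u t ^ 2 ∂μ := by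
  have hk1 : ∀ x, Measurable (k x) := fun x => hk.of_uncurry_left
  -- Cauchy–Schwarz for the splitting k u = (k w)^(1/2) (k w⁻¹ u²)^(1/2).
  have key : ∀ x, (∫⁻ t, k x t * u t ∂μ) ^ 2 ≤
      (∫⁻ t, k x t * w t ∂μ) * ∫⁻ t, k x t * ((w t)⁻¹ * u t ^ 2) ∂μ := by
    intro x
    have h := ENNReal.lintegral_mul_le_Lp_mul_Lq μ Real.HolderConjugate.two_two
      (f := fun t => (k x t * w t) ^ (1 / 2 : ℝ))
      (g := fun t => (k x t * ((w t)⁻¹ * u t ^ 2)) ^ (1 / 2 : ℝ))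
      (((hk1 x).mul hw).pow_const _).aemeasurable
      (((hk1 x).aemeasurable.mul (hw.inv.aemeasurable.mul (hu.pow_const 2))).pow_const (1 / 2 : ℝ))
    have hsq : ∀ z : ENNReal, (z ^ (1 / 2 : ℝ)) ^ (2 : ℝ) = z := fun z => by
      rw [← ENNReal.rpow_mul]; norm_num
    have hsq' : ∀ z : ENNReal, (z ^ (1 / 2 : ℝ)) ^ (2 : ℕ) = z := fun z => by
      rw [← ENNReal.rpow_natCast, ← ENNReal.rpow_mul]; norm_num
    have hsq'' : ∀ z : ENNReal, (z ^ (2 : ℕ)) ^ (1 / 2 : ℝ) = z := fun z => by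
      rw [← ENNReal.rpow_natCast, ← ENNReal.rpow_mul]; norm_num
    have heq : ∫⁻ t, k x t * u t ∂μ = ∫⁻ t, ((fun t => (k x t * w t) ^ (1 / 2 : ℝ)) *
        fun t => (k x t * ((w t)⁻¹ * u t ^ 2)) ^ (1 / 2 : ℝ)) t ∂μ := by
      refine lintegral_congr_ae ?_
      filter_upwards [hw0] with t ht
      simp only [Pi.mul_apply]
      rw [← ENNReal.mul_rpow_of_nonneg _ _ (by norm_num : (0 : ℝ) ≤ 1 / 2)]
      have : k x t * w t * (k x t * ((w t)⁻¹ * u t ^ 2)) = (k x t * u t) ^ 2 := by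
        calc _ = (w t * (w t)⁻¹) * (k x t * u t) ^ 2 := by ring
          _ = _ := by rw [ENNReal.mul_inv_cancel ht.1 ht.2, one_mul]
      rw [this, hsq'']
    rw [heq]
    refine (pow_le_pow_left₀ zero_le h 2).trans ?_
    simp only [hsq, mul_pow, hsq']
    exact le_rfl
  have hmeas : AEMeasurable (Function.uncurry fun x t => w x * (k x t * ((w t)⁻¹ * u t ^ 2)))
      (μ.prod μ) :=
    (hw.comp measurable_fst).aemeasurable.mul (hk.aemeasurable.mul
      ((hw.inv.comp measurable_snd).aemeasurable.mul
        ((hu.comp_quasiMeasurePreserving Measure.quasiMeasurePreserving_snd).pow_const 2)))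
  have hm2 : ∀ x, AEMeasurable (fun t => k x t * ((w t)⁻¹ * u t ^ 2)) μ := fun x =>
    (hk1 x).aemeasurable.mul (hw.inv.aemeasurable.mul (hu.pow_const _))
  calc ∫⁻ x, (∫⁻ t, k x t * u t ∂μ) ^ 2 ∂μ
      ≤ ∫⁻ x, c * ∫⁻ t, w x * (k x t * ((w t)⁻¹ * u t ^ 2)) ∂μ ∂μ := by
        refine lintegral_mono_ae ?_
        filter_upwards [hc] with x hx
        rw [lintegral_const_mul'' _ (hm2 x), ← mul_assoc]
        exact (key x).trans (by gcongr)
    _ = c * ∫⁻ t, ∫⁻ x, w x * (k x t * ((w t)⁻¹ * u t ^ 2)) ∂μ ∂μ := by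
        rw [lintegral_const_mul'' c (f := fun x => ∫⁻ t, w x * (k x t * ((w t)⁻¹ * u t ^ 2)) ∂μ)
          hmeas.lintegral_prod_right', lintegral_lintegral_swap hmeas]
    _ ≤ c * ∫⁻ t, c * u t ^ 2 ∂μ := by
        gcongr c * ?_
        refine lintegral_mono_ae ?_
        -- By symmetry of k, the weight bound also controls integration in the first variable.
        filter_upwards [hc, hw0] with t ht ht0
        calc ∫⁻ x, w x * (k x t * ((w t)⁻¹ * u t ^ 2)) ∂μ
            = ∫⁻ x, (k t x * w x) * ((w t)⁻¹ * u t ^ 2) ∂μ := by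
              refine lintegral_congr fun x => ?_
              rw [hsymm x t]; ring
          _ = (∫⁻ x, k t x * w x ∂μ) * ((w t)⁻¹ * u t ^ 2) :=
              lintegral_mul_const _ ((hk1 t).mul hw)
          _ ≤ (c * w t) * ((w t)⁻¹ * u t ^ 2) := by gcongr
          _ = (w t * (w t)⁻¹) * (c * u t ^ 2) := by ring
          _ = c * u t ^ 2 := by rw [ENNReal.mul_inv_cancel ht0.1 ht0.2, one_mul]
    _ = c ^ 2 * ∫⁻ t, u t ^ 2 ∂μ := by
        rw [lintegral_const_mul'' _ (hu.pow_const _)]; ring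

/-- A measurable kernel on `(0, ∞)` with values between `0` and the Stieltjes kernel. -/
structure IsStieltjesDominated (k : ℝ → ℝ → ℝ) : Prop where
  measurable : Measurable (Function.uncurry k)
  nonneg : ∀ x t, 0 < x → 0 < t → 0 ≤ k x t
  le : ∀ x t, 0 < x → 0 < t → k x t ≤ stieltjesKernel x t

theorem isStieltjesDominated_stieltjesKernel : IsStieltjesDominated stieltjesKernel :=
  ⟨measurable_stieltjesKernel, fun _ _ => stieltjesKernel_nonneg, fun _ _ _ _ => le_rfl⟩

theorem isStieltjesDominated_logKernel : IsStieltjesDominated logKernel :=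
  ⟨measurable_logKernel, fun _ _ hx ht => (logKernel_nonneg_and_le hx ht).1,
    fun _ _ hx ht => (logKernel_nonneg_and_le hx ht).2⟩

theorem memLp_stieltjesKernel {x : ℝ} (hx : 0 < x) : MemLp (stieltjesKernel x) 2 halfLine := by
  rw [memLp_two_iff_integrable_sq measurable_stieltjesKernel.of_uncurry_left.aestronglyMeasurable]
  refine Integrable.mono' ((integrable_inv_one_add_sq.restrict (s := Ioi 0)).const_mul (1 + 1 / x ^ 2))
    (measurable_stieltjesKernel.of_uncurry_left.pow_const 2).aestronglyMeasurable ?_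
  filter_upwards [ae_halfLine_pos] with t ht
  rw [Real.norm_of_nonneg (by positivity), stieltjesKernel, div_pow, one_pow,
    show 1 + 1 / x ^ 2 = (x ^ 2 + 1) / x ^ 2 by field_simp, ← div_eq_mul_inv, div_div,
    div_le_div_iff₀ (by positivity) (by positivity)]
  nlinarith [mul_pos hx ht, pow_pos hx 2, pow_pos hx 3, pow_pos ht 2, mul_pos (pow_pos hx 3) ht,
    mul_pos (pow_pos hx 2) (pow_pos ht 2)]

namespace IsStieltjesDominated

variable {𝕜 : Type*} [RCLike 𝕜] {k l : ℝ → ℝ → ℝ} {u : ℝ → 𝕜}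

theorem memLp (hk : IsStieltjesDominated k) {x : ℝ} (hx : 0 < x) : MemLp (k x) 2 halfLine := by
  refine (memLp_stieltjesKernel hx).mono hk.measurable.of_uncurry_left.aestronglyMeasurable ?_
  filter_upwards [ae_halfLine_pos] with t ht
  rw [Real.norm_of_nonneg (hk.nonneg x t hx ht),
    Real.norm_of_nonneg (stieltjesKernel_nonneg hx ht)]
  exact hk.le x t hx ht

theorem integrable (hk : IsStieltjesDominated k) (hu : MemLp u 2 halfLine) {x : ℝ} (hx : 0 < x) :
    Integrable (fun t => k x t • u t) halfLine :=
  memLp_one_iff_integrable.1 (hu.smul (r := 1) (hk.memLp hx))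

theorem aestronglyMeasurable_uncurry (hk : IsStieltjesDominated k) (hu : MemLp u 2 halfLine) :
    AEStronglyMeasurable (fun p : ℝ × ℝ => k p.1 p.2 • u p.2) (halfLine.prod halfLine) :=
  AEStronglyMeasurable.smul (f := fun p : ℝ × ℝ => k p.1 p.2)
    hk.measurable.aestronglyMeasurable hu.1.comp_snd

theorem memLp_integral (hk : IsStieltjesDominated k) (hu : MemLp u 2 halfLine) :
    MemLp (fun x => ∫ t, k x t • u t ∂halfLine) 2 halfLine := by
  refine ⟨(hk.aestronglyMeasurable_uncurry hu).integral_prod_right', ?_⟩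
  rw [eLpNorm_lt_top_iff_lintegral_rpow_enorm_lt_top two_ne_zero ENNReal.ofNat_ne_top]
  have hu2 := (eLpNorm_lt_top_iff_lintegral_rpow_enorm_lt_top two_ne_zero
    ENNReal.ofNat_ne_top).1 hu.2
  simp only [ENNReal.toReal_ofNat, ENNReal.rpow_ofNat] at hu2 ⊢
  have hschur := lintegral_sq_lintegral_mul_le (μ := halfLine)
    (k := fun x t => ENNReal.ofReal (stieltjesKernel x t))
    (w := fun t => ENNReal.ofReal (1 / √t)) (u := fun t => ‖u t‖ₑ) (c := ENNReal.ofReal Real.pi)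
    measurable_stieltjesKernel.ennreal_ofReal
    (fun x t => by rw [stieltjesKernel_comm]) (by fun_prop)
    (by
      filter_upwards [ae_halfLine_pos] with t ht
      have : 0 < √t := Real.sqrt_pos.2 ht
      exact ⟨by simpa using this, ENNReal.ofReal_ne_top⟩)
    hu.1.enorm
    (by
      filter_upwards [ae_halfLine_pos] with x hx
      exact (lintegral_stieltjesKernel_mul_inv_sqrt hx).le)
  refine (lintegral_mono_ae ?_).trans_lt
    (hschur.trans_lt (ENNReal.mul_lt_top (by simp) hu2))
  filter_upwards [ae_halfLine_pos] with x hx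
  gcongr
  refine (enorm_integral_le_lintegral_enorm _).trans (lintegral_mono_ae ?_)
  filter_upwards [ae_halfLine_pos] with t ht
  rw [enorm_smul, Real.enorm_of_nonneg (hk.nonneg x t hx ht)]
  gcongr
  exact hk.le x t hx ht

theorem integral_smul_integral (hk : IsStieltjesDominated k) (hl : IsStieltjesDominated l)
    (hu : MemLp u 2 halfLine) {x : ℝ} (hx : 0 < x) :
    ∫ y, k x y • ∫ t, l y t • u t ∂halfLine ∂halfLine =
      ∫ t, (∫ y, k x y * l y t ∂halfLine) • u t ∂halfLine := by
  have hint : Integrable (Function.uncurry fun y t => k x y • l y t • u t)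
      (halfLine.prod halfLine) := by
    have hm : AEStronglyMeasurable (Function.uncurry fun y t => k x y • l y t • u t)
        (halfLine.prod halfLine) :=
      AEStronglyMeasurable.smul (f := fun p : ℝ × ℝ => k x p.1)
        (hk.measurable.of_uncurry_left.comp measurable_fst).aestronglyMeasurable
        (hl.aestronglyMeasurable_uncurry hu)
    rw [integrable_prod_iff hm]
    constructor
    · filter_upwards [ae_halfLine_pos] with y hy
      exact (hl.integrable hu hy).smul (k x y)
    -- Absolute integrability: l applied to ‖u‖ stays in L₂, and so pairs with k(x, ·).
    · refine (hk.integrable (hl.memLp_integral hu.norm) hx).congr ?_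
      filter_upwards [ae_halfLine_pos] with y hy
      rw [← integral_smul]
      refine integral_congr_ae ?_
      filter_upwards [ae_halfLine_pos] with t ht
      simp only [Function.uncurry, norm_smul, smul_eq_mul]
      rw [Real.norm_of_nonneg (hk.nonneg x y hx hy), Real.norm_of_nonneg (hl.nonneg y t hy ht)]
  simp_rw [← integral_smul]
  rw [integral_integral_swap hint]
  simp_rw [smul_smul, integral_smul_const]

end IsStieltjesDominated

/-! ### The two sides as mutually inverse operators -/

section

variable {𝕜 : Type*} [RCLike 𝕜] {u v : ℝ → 𝕜}

theorem integral_logKernel_mul_stieltjesKernel {x t : ℝ} (hx : 0 < x) (ht : 0 < t)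
    (hxt : x ≠ t) :
    ∫ y, logKernel x y * stieltjesKernel y t ∂halfLine =
      Real.pi ^ 2 / 2 * stieltjesKernel x t - Real.pi * logKernel x t := by
  rw [stieltjesKernel_comm x, logKernel_comm x,
    ← integral_stieltjesKernel_mul_logKernel ht hx hxt.symm]
  refine integral_congr_ae (ae_of_all _ fun y => ?_)
  simp only
  rw [mul_comm, stieltjesKernel_comm y, logKernel_comm x]

/-- Serves both orders of composition. The kernel identity is needed only off the null set t = x. -/
theorem integral_smul_integral_eq_of_kernel {k l : ℝ → ℝ → ℝ} (hk : IsStieltjesDominated k)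
    (hl : IsStieltjesDominated l) (hu : MemLp u 2 halfLine) {x : ℝ} (hx : 0 < x)
    (h : ∀ t, 0 < t → x ≠ t → ∫ y, k x y * l y t ∂halfLine =
      Real.pi ^ 2 / 2 * stieltjesKernel x t - Real.pi * logKernel x t) :
    ∫ y, k x y • ∫ t, l y t • u t ∂halfLine ∂halfLine =
      (Real.pi ^ 2 / 2) • ∫ t, stieltjesKernel x t • u t ∂halfLine -
        Real.pi • ∫ t, logKernel x t • u t ∂halfLine := by
  rw [hk.integral_smul_integral hl hu hx, ← integral_smul, ← integral_smul, ← integral_sub]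
  rotate_left
  · exact (isStieltjesDominated_stieltjesKernel.integrable hu hx).smul (Real.pi ^ 2 / 2)
  · exact (isStieltjesDominated_logKernel.integrable hu hx).smul Real.pi
  refine integral_congr_ae ?_
  filter_upwards [ae_halfLine_pos, ae_halfLine_ne x] with t ht hxt
  rw [h t ht hxt, sub_smul, mul_smul, mul_smul]

theorem memLp_stieltjesSide (hu : MemLp u 2 halfLine) : MemLp (stieltjesSide u) 2 halfLine :=
  hu.add ((isStieltjesDominated_stieltjesKernel.memLp_integral hu).const_smul (1 / Real.pi))

theorem memLp_logSide (hu : MemLp u 2 halfLine) : MemLp (logSide u) 2 halfLine :=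
  hu.sub ((isStieltjesDominated_logKernel.memLp_integral hu).const_smul (2 / Real.pi ^ 2))

/-- S(u − (2/π²)Lu) = Su − (Su − (2/π)Lu) = (2/π)Lu; divided by π, this cancels the correction in
`logSide`. -/
theorem stieltjesSide_logSide (hu : MemLp u 2 halfLine) {x : ℝ} (hx : 0 < x) :
    stieltjesSide (logSide u) x = u x := by
  have hS := isStieltjesDominated_stieltjesKernel
  have hL := isStieltjesDominated_logKernel
  have hpi := Real.pi_ne_zero
  have hLu : MemLp (fun x => (2 / Real.pi ^ 2) • ∫ t, logKernel x t • u t ∂halfLine) 2 halfLine :=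
    (hL.memLp_integral hu).const_smul (2 / Real.pi ^ 2)
  have h : ∫ t, stieltjesKernel x t • logSide u t ∂halfLine =
      Real.pi • (2 / Real.pi ^ 2) • ∫ t, logKernel x t • u t ∂halfLine := by
    simp only [logSide, smul_sub]
    rw [integral_sub (hS.integrable hu hx) (hS.integrable hLu hx)]
    simp_rw [smul_comm _ (2 / Real.pi ^ 2)]
    rw [integral_smul, integral_smul_integral_eq_of_kernel hS hL hu hx
      fun t ht hxt => integral_stieltjesKernel_mul_logKernel hx ht hxt, smul_sub, smul_smul,
      show 2 / Real.pi ^ 2 * (Real.pi ^ 2 / 2) = 1 by field_simp, one_smul, sub_sub_cancel]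
  rw [stieltjesSide, h, smul_smul, one_div_mul_cancel hpi, one_smul, logSide, sub_add_cancel]

/-- L(u + (1/π)Su) = Lu + (π/2)Su − Lu = (π/2)Su; multiplied by 2/π², this is the term that
`stieltjesSide` added. -/
theorem logSide_stieltjesSide (hu : MemLp u 2 halfLine) {x : ℝ} (hx : 0 < x) :
    logSide (stieltjesSide u) x = u x := by
  have hS := isStieltjesDominated_stieltjesKernel
  have hL := isStieltjesDominated_logKernel
  have hpi := Real.pi_ne_zero
  have hSu : MemLp (fun x => (1 / Real.pi) • ∫ t, stieltjesKernel x t • u t ∂halfLine) 2 halfLine :=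
    (hS.memLp_integral hu).const_smul (1 / Real.pi)
  have h : ∫ t, logKernel x t • stieltjesSide u t ∂halfLine =
      (Real.pi ^ 2 / 2) • (1 / Real.pi) • ∫ t, stieltjesKernel x t • u t ∂halfLine := by
    simp only [stieltjesSide, smul_add]
    rw [integral_add (hL.integrable hu hx) (hL.integrable hSu hx)]
    simp_rw [smul_comm _ (1 / Real.pi)]
    rw [integral_smul, integral_smul_integral_eq_of_kernel hL hS hu hx
      fun t ht hxt => integral_logKernel_mul_stieltjesKernel hx ht hxt, smul_sub,
      smul_smul (1 / Real.pi) Real.pi, one_div_mul_cancel hpi, one_smul, add_sub_cancel,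
      smul_comm]
  rw [logSide, h, smul_smul, show 2 / Real.pi ^ 2 * (Real.pi ^ 2 / 2) = 1 by field_simp, one_smul,
    stieltjesSide, add_sub_cancel_right]

theorem stieltjesSide_congr_ae (h : u =ᵐ[halfLine] v) :
    stieltjesSide u =ᵐ[halfLine] stieltjesSide v := by
  filter_upwards [h] with x hx
  have hint : ∫ t, stieltjesKernel x t • u t ∂halfLine = ∫ t, stieltjesKernel x t • v t ∂halfLine :=
    integral_congr_ae (h.mono fun t ht => by simp only [ht])
  rw [stieltjesSide, stieltjesSide, hx, hint]

theorem logSide_congr_ae (h : u =ᵐ[halfLine] v) : logSide u =ᵐ[halfLine] logSide v := by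
  filter_upwards [h] with x hx
  have hint : ∫ t, logKernel x t • u t ∂halfLine = ∫ t, logKernel x t • v t ∂halfLine :=
    integral_congr_ae (h.mono fun t ht => by simp only [ht])
  rw [logSide, logSide, hx, hint]

end

theorem corollary1 {𝕜 : Type*} [RCLike 𝕜] :
    -- both integrals converge absolutely, for every square-integrable function and every `x > 0`
    (∀ u : ℝ → 𝕜, MemLp u 2 halfLine → ∀ x : ℝ, 0 < x →
      Integrable (fun t => stieltjesKernel x t • u t) halfLine ∧
      Integrable (fun t => logKernel x t • u t) halfLine) ∧
    -- for given `g`, the function `logSide g` is in `L₂`, solves the equation at every `x > 0`,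
    -- and is the only solution in `L₂`
    (∀ g : ℝ → 𝕜, MemLp g 2 halfLine →
      MemLp (logSide g) 2 halfLine ∧
      (∀ x : ℝ, 0 < x → stieltjesSide (logSide g) x = g x) ∧
      (∀ f : ℝ → 𝕜, MemLp f 2 halfLine →
        (∀ᵐ x ∂halfLine, stieltjesSide f x = g x) → f =ᵐ[halfLine] logSide g)) ∧
    -- for given `f`, the function `stieltjesSide f` is in `L₂`, solves the second equation at
    -- every `x > 0`, and is the only solution in `L₂`
    (∀ f : ℝ → 𝕜, MemLp f 2 halfLine →
      MemLp (stieltjesSide f) 2 halfLine ∧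
      (∀ x : ℝ, 0 < x → f x = logSide (stieltjesSide f) x) ∧
      (∀ g : ℝ → 𝕜, MemLp g 2 halfLine →
        (∀ᵐ x ∂halfLine, f x = logSide g x) → g =ᵐ[halfLine] stieltjesSide f)) := by
  refine ⟨fun u hu x hx => ⟨isStieltjesDominated_stieltjesKernel.integrable hu hx,
    isStieltjesDominated_logKernel.integrable hu hx⟩, fun g hg => ⟨memLp_logSide hg,
    fun x hx => stieltjesSide_logSide hg hx, fun f hf h => ?_⟩, fun f hf =>
    ⟨memLp_stieltjesSide hf, fun x hx => (logSide_stieltjesSide hf hx).symm, fun g hg h => ?_⟩⟩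
  -- Uniqueness: apply the inverse operator to the equation, which is permitted since it respects
  -- a.e. equality.
  · filter_upwards [ae_halfLine_pos, logSide_congr_ae h] with x hx hx'
    rw [← hx', logSide_stieltjesSide hf hx]
  · filter_upwards [ae_halfLine_pos, stieltjesSide_congr_ae h] with x hx hx'
    rw [hx', stieltjesSide_logSide hg hx]
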